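/- Let $n\ge 0$ and let $\mathcal{B}(n)$ be the family of all subsets of $[n]=\{1,\dots,n\}$, ordered by inclusion. Let $\mathcal{C}\subseteq\mathcal{B}(n)$ be convex, that is, whenever $X,Y\in\mathcal{C}$ and $X\subseteq Z\subseteq Y$, then $Z\in\mathcal{C}$. Let $w(\mathcal{C})$ be the width of $\mathcal{C}$, the maximum size of an antichain contained in $\mathcal{C}$. Then $\mathcal{C}$ can be partitioned into exactly $w(\mathcal{C})$ nonempty chains each of which is skipless: whenever $Y$ is the immediate successor of $X$ in the chain, $Y$ covers $X$ in $\mathcal{C}$ (that is, no element of $\mathcal{C}$ lies strictly between $X$ and $Y$), and in fact $|Y|=|X|+1$. -/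

import Mathlib

/-- The width of a finite subset `X` of a partially ordered set: the maximum size of an
antichain contained in `X`. -/
noncomputable def width {α : Type*} [PartialOrder α] (X : Finset α) : ℕ :=
  open Classical in
  (X.powerset.filter fun A : Finset α => IsAntichain (· ≤ ·) (A : Set α)).sup Finset.card

/-- `y` covers `x` in the induced order on `X`: `x < y` are elements of `X`, and no element
of `X` other than `x` and `y` lies between them. -/
def CoversIn {α : Type*} [PartialOrder α] (X : Finset α) (x y : α) : Prop :=
  x ∈ X ∧ y ∈ X ∧ x < y ∧ ∀ z ∈ X, x ≤ z → z ≤ y → z = x ∨ z = y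

/-- A skipless chain in `X`: a chain `c ⊆ X` such that any two consecutive elements of `c`
form a cover in `X`. -/
structure IsSkiplessChain {α : Type*} [PartialOrder α] (X c : Finset α) : Prop where
  subset : c ⊆ X
  isChain : IsChain (· ≤ ·) (c : Set α)
  covers : ∀ x y : α, CoversIn c x y → CoversIn X x y

/-- An SD-partition of `X`: a partition of `X` into exactly `width X` chains (a Dilworth
partition), all of which are skipless in `X`. -/
structure IsSDPartition {α : Type*} [PartialOrder α] [DecidableEq α] (X : Finset α)
    (P : Finpartition X) : Prop where
  card_parts : P.parts.card = width X
  skipless : ∀ c ∈ P.parts, IsSkiplessChain X c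

/-!
Let `N U` denote the set of elements of `C` covering some element of `U`. Choose `U ⊆ C` maximising
the deficiency `#U - #(N U)` and, among the maximisers, maximal for inclusion. By Hall's theorem
`V = N U` can be matched into `U` along covers `m v ⋖ v`. If `v ⋖ z` is a cover in `C` with `v ∈ V`
and `z ∉ V`, a second element `w` between `m v` and `z` lies in `V \ U`, and double counting the
pairs `(v, z)` gives `#(N V \ V) ≤ #(V \ U)`. So `U ∪ V` has maximal deficiency as well, whence
`V ⊆ U`. Then `U \ V` is an antichain whose size `D` is the maximal deficiency. By the deficiency
form of Hall's theorem, all but at most `D` elements of `C` can be injectively sent to an element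
covering them. The orbits of this partial map are chains of covers, at most `D ≤ width C` of them.
-/

open Finset

section Hall

variable {ι β : Type*} [DecidableEq β]

lemma exists_injOn_of_card_le_card_biUnion [Nonempty (ι → β)] {s : Finset ι} {t : ι → Finset β}
    (h : ∀ s' ⊆ s, #s' ≤ #(s'.biUnion t)) : ∃ f : ι → β, Set.InjOn f s ∧ ∀ x ∈ s, f x ∈ t x := by
  classical
  obtain ⟨d⟩ := ‹Nonempty (ι → β)›
  obtain ⟨f, hf, hft⟩ := (all_card_le_biUnion_card_iff_exists_injective fun x : s => t x).1
    fun s' => by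
      simpa only [card_image_of_injective _ Subtype.val_injective, image_biUnion] using
        h (s'.image (↑)) (image_subset_iff.2 fun x _ => x.2)
  refine ⟨fun x => if hx : x ∈ s then f ⟨x, hx⟩ else d x, fun x hx y hy hxy => ?_, fun x hx => ?_⟩
  · simp only [mem_coe.1 hx, mem_coe.1 hy, dif_pos] at hxy
    exact congrArg Subtype.val (hf hxy)
  · simpa only [hx, dif_pos] using hft ⟨x, hx⟩

-- Hall's theorem applies once `D` dummy elements are added to every `t x`.
lemma exists_injOn_of_card_le_card_biUnion_add [DecidableEq ι] [Nonempty (ι → β)] {s : Finset ι}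
    {t : ι → Finset β} {D : ℕ} (h : ∀ s' ⊆ s, #s' ≤ #(s'.biUnion t) + D) :
    ∃ M ⊆ s, #(s \ M) ≤ D ∧ ∃ f : ι → β, Set.InjOn f M ∧ ∀ x ∈ M, f x ∈ t x := by
  obtain ⟨d⟩ := ‹Nonempty (ι → β)›
  have : Nonempty (ι → β ⊕ Fin D) := ⟨Sum.inl ∘ d⟩
  obtain ⟨g, hg, hgt⟩ := exists_injOn_of_card_le_card_biUnion (s := s)
    (t := fun x => (t x).disjSum (univ : Finset (Fin D))) fun s' hs' => by
      obtain rfl | ⟨a, ha⟩ := s'.eq_empty_or_nonempty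
      · simp
      calc #s' ≤ #(s'.biUnion t) + #(univ : Finset (Fin D)) := by simpa using h s' hs'
        _ = #((s'.biUnion t).disjSum univ) := (card_disjSum _ _).symm
        _ ≤ #(s'.biUnion fun x => (t x).disjSum univ) := card_le_card fun w hw => by
          obtain ⟨y, hy, rfl⟩ | ⟨i, -, rfl⟩ := mem_disjSum.1 hw
          · obtain ⟨x, hx, hxy⟩ := mem_biUnion.1 hy
            exact mem_biUnion.2 ⟨x, hx, inl_mem_disjSum.2 hxy⟩
          · exact mem_biUnion.2 ⟨a, ha, inr_mem_disjSum.2 (mem_univ i)⟩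
  have hleft : ∀ x, (g x).isLeft → g x = .inl ((g x).elim id fun _ => d x) := fun x hx => by
    obtain ⟨y, hy⟩ := Sum.isLeft_iff.1 hx
    simp [hy]
  refine ⟨{x ∈ s | (g x).isLeft}, filter_subset _ _, ?_, fun x => (g x).elim id fun _ => d x,
    fun x hx y hy hxy => ?_, fun x hx => ?_⟩
  · suffices #(s \ {x ∈ s | (g x).isLeft}) ≤
        #((univ : Finset (Fin D)).map .inr : Finset (β ⊕ Fin D)) by
      rwa [card_map, card_fin] at this
    refine card_le_card_of_injOn g (fun x hx => ?_) (hg.mono (coe_subset.2 sdiff_subset))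
    obtain ⟨hxs, hx⟩ := mem_sdiff.1 hx
    rcases hgx : g x with y | i
    · exact absurd (mem_filter.2 ⟨hxs, by simp [hgx]⟩) hx
    · simp
  · obtain ⟨hxs, hx⟩ := mem_filter.1 hx
    obtain ⟨hys, hy⟩ := mem_filter.1 hy
    exact hg hxs hys ((hleft x hx).trans ((congrArg Sum.inl hxy).trans (hleft y hy).symm))
  · obtain ⟨hxs, hx⟩ := mem_filter.1 hx
    exact inl_mem_disjSum.1 (hleft x hx ▸ hgt x hxs)

/-- `U` maximises the deficiency `#U - #(U.biUnion t)` of the set system `t` among the subsets of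
`s`. The inequality is rearranged so as to avoid subtraction in `ℕ`. -/
def IsMaxDeficient (t : ι → Finset β) (s U : Finset ι) : Prop :=
  U ⊆ s ∧ ∀ U' ⊆ s, #U' + #(U.biUnion t) ≤ #U + #(U'.biUnion t)

lemma exists_maximal_isMaxDeficient (t : ι → Finset β) (s : Finset ι) :
    ∃ U, Maximal (IsMaxDeficient t s) U := by
  refine Set.Finite.exists_maximal (s := {U | IsMaxDeficient t s U})
    (s.powerset.finite_toSet.subset fun U hU => mem_powerset.2 hU.1) ?_
  obtain ⟨U, hU, hmax⟩ := exists_max_image s.powerset (fun U => (#U : ℤ) - #(U.biUnion t))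
    ⟨∅, empty_mem_powerset s⟩
  refine ⟨U, mem_powerset.1 hU, fun U' hU' => ?_⟩
  have := hmax U' (mem_powerset.2 hU')
  omega

-- Removing from `U` the elements that could be matched to `B` would increase the deficiency of
-- `U` if Hall's condition failed for `B`.
lemma IsMaxDeficient.exists_injOn_biUnion [Nonempty (β → ι)] {t : ι → Finset β}
    {s U : Finset ι} (h : IsMaxDeficient t s U) :
    ∃ m : β → ι, Set.InjOn m (U.biUnion t) ∧ ∀ b ∈ U.biUnion t, m b ∈ U ∧ b ∈ t (m b) := by
  classical
  suffices ∃ m : β → ι, Set.InjOn m (U.biUnion t) ∧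
      ∀ b ∈ U.biUnion t, m b ∈ ({u ∈ U | b ∈ t u} : Finset ι) by
    simpa only [mem_filter] using this
  refine exists_injOn_of_card_le_card_biUnion (t := fun b => {u ∈ U | b ∈ t u}) fun B hB => ?_
  set K := B.biUnion fun b => {u ∈ U | b ∈ t u}
  have hKU : K ⊆ U := biUnion_subset.2 fun b _ => filter_subset _ _
  have hdisj : (U \ K).biUnion t ⊆ U.biUnion t \ B := fun b hb => by
    obtain ⟨u, hu, hbu⟩ := mem_biUnion.1 hb
    obtain ⟨huU, huK⟩ := mem_sdiff.1 hu
    exact mem_sdiff.2 ⟨mem_biUnion.2 ⟨u, huU, hbu⟩, fun hbB =>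
      huK (mem_biUnion.2 ⟨b, hbB, mem_filter.2 ⟨huU, hbu⟩⟩)⟩
  have hmax := h.2 (U \ K) (sdiff_subset.trans h.1)
  have hcard := card_le_card hdisj
  have hK := card_sdiff_add_card_eq_card hKU
  have hB := card_sdiff_add_card_eq_card hB
  omega

end Hall

section Fibers

variable {π σ τ : Type*}

lemma sum_inv_card_fiber [DecidableEq σ] (P : Finset π) (f : π → σ) :
    ∑ p ∈ P, (#{q ∈ P | f q = f p} : ℚ)⁻¹ = #(P.image f) := by
  rw [← sum_fiberwise_of_maps_to fun _ => mem_image_of_mem f, card_eq_sum_ones, Nat.cast_sum]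
  refine sum_congr rfl fun s hs => ?_
  obtain ⟨p, hp, rfl⟩ := mem_image.1 hs
  have hpos : (#{q ∈ P | f q = f p} : ℚ) ≠ 0 :=
    Nat.cast_ne_zero.2 (card_ne_zero_of_mem (mem_filter.2 ⟨hp, rfl⟩))
  calc ∑ p' ∈ P with f p' = f p, (#{q ∈ P | f q = f p'} : ℚ)⁻¹
      = ∑ p' ∈ P with f p' = f p, (#{q ∈ P | f q = f p} : ℚ)⁻¹ :=
        sum_congr rfl fun p' hp' => by rw [(mem_filter.1 hp').2]
    _ = ((1 : ℕ) : ℚ) := by rw [sum_const, nsmul_eq_mul, mul_inv_cancel₀ hpos, Nat.cast_one]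

lemma card_image_le_card_image_of_card_fiber_le [DecidableEq σ] [DecidableEq τ] {P : Finset π}
    {f : π → σ} {g : π → τ}
    (h : ∀ p ∈ P, #{q ∈ P | g q = g p} ≤ #{q ∈ P | f q = f p}) :
    #(P.image f) ≤ #(P.image g) := by
  have : (#(P.image f) : ℚ) ≤ #(P.image g) := by
    rw [← sum_inv_card_fiber, ← sum_inv_card_fiber]
    refine sum_le_sum fun p hp => inv_anti₀ ?_ (Nat.cast_le.2 (h p hp))
    exact Nat.cast_pos.2 (card_pos.2 ⟨p, mem_filter.2 ⟨hp, rfl⟩⟩)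
  exact_mod_cast this

end Fibers

section GrandOrbits

variable {α : Type*}

/-- Two points are in the same grand orbit of `f` when their forward orbits meet. -/
def grandOrbit (f : α → α) : Setoid α where
  r x y := ∃ m n, f^[m] x = f^[n] y
  iseqv :=
    { refl := fun _ => ⟨0, 0, rfl⟩
      symm := fun ⟨m, n, h⟩ => ⟨n, m, h.symm⟩
      trans := fun {x y z} ⟨m, n, hxy⟩ ⟨p, q, hyz⟩ => ⟨p + m, n + q, by
        rw [f.iterate_add_apply, hxy, ← f.iterate_add_apply, add_comm, f.iterate_add_apply, hyz,
          ← f.iterate_add_apply]⟩ }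

-- Two different points with the same image cannot both move, and steps at a fixed point can be
-- dropped; so the common part of the two orbits can be cancelled one step at a time.
lemma exists_iterate_eq_of_grandOrbit {f : α → α} (hf : Set.InjOn f (Function.fixedPoints f)ᶜ)
    {x y : α} (h : grandOrbit f x y) : (∃ k, f^[k] x = y) ∨ ∃ k, f^[k] y = x := by
  obtain ⟨m, n, h⟩ := h
  induction m generalizing n with
  | zero => exact .inr ⟨n, h.symm⟩
  | succ m ihm =>
    induction n with
    | zero => exact .inl ⟨m + 1, h⟩
    | succ n ihn =>
      by_cases hx : Function.IsFixedPt f (f^[m] x)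
      · rw [f.iterate_succ_apply', hx] at h
        exact ihm _ h
      by_cases hy : Function.IsFixedPt f (f^[n] y)
      · rw [f.iterate_succ_apply' n, hy] at h
        exact ihn h
      rw [f.iterate_succ_apply', f.iterate_succ_apply'] at h
      exact ihm _ (hf hx hy h)

/-- The partition of `C` into the traces of the grand orbits of `f`. -/
noncomputable def grandOrbitPartition [DecidableEq α] (f : α → α) (C : Finset α) :
    Finpartition C :=
  open Classical in .ofSetSetoid (grandOrbit f) C

variable [DecidableEq α] {f : α → α} {C c : Finset α} {x y : α}

lemma grandOrbit_of_mem (hc : c ∈ (grandOrbitPartition f C).parts) (hx : x ∈ c) (hy : y ∈ c) :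
    grandOrbit f x y := by
  classical
  rw [← (grandOrbitPartition f C).part_eq_of_mem hc hx] at hy
  exact ((Finpartition.mem_part_ofSetSetoid_iff_rel C).1 hy).2.2

lemma apply_mem_of_mem (hfC : Set.MapsTo f C C) (hc : c ∈ (grandOrbitPartition f C).parts)
    (hx : x ∈ c) : f x ∈ c := by
  classical
  have hxC := (grandOrbitPartition f C).le hc hx
  rw [← (grandOrbitPartition f C).part_eq_of_mem hc hx]
  exact (Finpartition.mem_part_ofSetSetoid_iff_rel C).2 ⟨hxC, hfC hxC, 1, 0, rfl⟩

variable [PartialOrder α]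

lemma isChain_of_mem_grandOrbitPartition (hf : Set.InjOn f (Function.fixedPoints f)ᶜ)
    (hle : id ≤ f) (hc : c ∈ (grandOrbitPartition f C).parts) :
    IsChain (· ≤ ·) (c : Set α) := by
  intro x hx y hy _
  obtain ⟨k, rfl⟩ | ⟨k, rfl⟩ := exists_iterate_eq_of_grandOrbit hf (grandOrbit_of_mem hc hx hy)
  · exact .inl (Function.id_le_iterate_of_id_le hle k x)
  · exact .inr (Function.id_le_iterate_of_id_le hle k y)

lemma apply_eq_of_coversIn (hf : Set.InjOn f (Function.fixedPoints f)ᶜ) (hle : id ≤ f)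
    (hfC : Set.MapsTo f C C) (hc : c ∈ (grandOrbitPartition f C).parts) (h : CoversIn c x y) :
    f x = y := by
  obtain ⟨hx, hy, hlt, hbetween⟩ := h
  obtain ⟨k, rfl⟩ | ⟨k, rfl⟩ := exists_iterate_eq_of_grandOrbit hf (grandOrbit_of_mem hc hx hy)
  · rcases k with _ | k
    · exact absurd hlt (lt_irrefl x)
    obtain hfix | hfix := hbetween (f x) (apply_mem_of_mem hfC hc hx) (hle x)
      (Function.id_le_iterate_of_id_le hle k (f x))
    · exact absurd (Function.iterate_fixed hfix (k + 1)) hlt.ne'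
    · exact hfix
  · exact absurd (Function.id_le_iterate_of_id_le hle k y) hlt.not_ge

lemma card_parts_grandOrbitPartition_le (hle : id ≤ f) (hfC : Set.MapsTo f C C) :
    #(grandOrbitPartition f C).parts ≤ #{x ∈ C | f x = x} := by
  refine card_le_card_of_surjOn (grandOrbitPartition f C).part fun c hc => ?_
  obtain ⟨x, hx⟩ := c.exists_maximal ((grandOrbitPartition f C).nonempty_of_mem_parts hc)
  have hfix : f x = x := (hx.eq_of_le (apply_mem_of_mem hfC hc hx.1) (hle x)).symm
  exact ⟨x, mem_filter.2 ⟨(grandOrbitPartition f C).le hc hx.1, hfix⟩,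
    (grandOrbitPartition f C).part_eq_of_mem hc hx.1⟩

lemma exists_finpartition_isChain {M : Finset α} (hf : Set.InjOn f M)
    (hlt : ∀ x ∈ M, x < f x) (hfC : ∀ x ∈ M, f x ∈ C) :
    ∃ P : Finpartition C, #P.parts ≤ #(C \ M) ∧ ∀ c ∈ P.parts, IsChain (· ≤ ·) (c : Set α) ∧
      ∀ x y, CoversIn c x y → x ∈ M ∧ f x = y := by
  let F := M.piecewise f id
  have hF : ∀ x ∈ M, F x = f x := fun x hx => piecewise_eq_of_mem M f id hx
  have hF' : ∀ x ∉ M, F x = x := fun x hx => piecewise_eq_of_notMem M f id hx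
  have hinj : Set.InjOn F (Function.fixedPoints F)ᶜ := (hf.congr fun x hx => (hF x hx).symm).mono
    fun x hx => by_contra fun hxM => hx (hF' x hxM)
  have hle : id ≤ F := fun x => by
    by_cases hx : x ∈ M
    · exact (hlt x hx).le.trans_eq (hF x hx).symm
    · exact (hF' x hx).ge
  have hFC : Set.MapsTo F C C := fun x hx => by
    by_cases hxM : x ∈ M
    · exact (hF x hxM).symm ▸ hfC x hxM
    · exact (hF' x hxM).symm ▸ hx
  have hfix : {x ∈ C | F x = x} ⊆ C \ M := fun x hx => by
    obtain ⟨hxC, hx⟩ := mem_filter.1 hx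
    exact mem_sdiff.2 ⟨hxC, fun hxM => (hlt x hxM).ne' ((hF x hxM).symm.trans hx)⟩
  refine ⟨grandOrbitPartition F C, (card_parts_grandOrbitPartition_le hle hFC).trans
    (card_le_card hfix), fun c hc => ⟨isChain_of_mem_grandOrbitPartition hinj hle hc,
    fun x y hxy => ?_⟩⟩
  have hy := apply_eq_of_coversIn hinj hle hFC hc hxy
  have hxM : x ∈ M := by_contra fun hxM => hxy.2.2.1.ne ((hF' x hxM).symm.trans hy)
  exact ⟨hxM, (hF x hxM).symm.trans hy⟩

end GrandOrbits

section Width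

variable {α : Type*} [PartialOrder α] {X : Finset α}

lemma card_le_width_of_isAntichain {A : Finset α} (h : IsAntichain (· ≤ ·) (A : Set α))
    (hA : A ⊆ X) : #A ≤ width X := by
  classical
  exact le_sup (f := Finset.card) (mem_filter.2 ⟨mem_powerset.2 hA, h⟩)

lemma width_le_card_parts [DecidableEq α] (P : Finpartition X)
    (h : ∀ c ∈ P.parts, IsChain (· ≤ ·) (c : Set α)) : width X ≤ #P.parts := by
  classical
  refine Finset.sup_le fun A hA => ?_
  obtain ⟨hAX, hA⟩ := mem_filter.1 hA
  rw [mem_powerset] at hAX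
  refine card_le_card_of_injOn P.part (fun a ha => P.part_mem.2 (hAX ha)) fun a ha b hb hab => ?_
  exact inter_subsingleton_of_isChain_of_isAntichain (h _ (P.part_mem.2 (hAX ha))) hA
    ⟨P.mem_part_self.2 (hAX ha), ha⟩ ⟨hab ▸ P.mem_part_self.2 (hAX hb), hb⟩

lemma coversIn_of_covBy {x y : α} (hx : x ∈ X) (hy : y ∈ X) (h : x ⋖ y) : CoversIn X x y :=
  ⟨hx, hy, h.lt, fun _ _ hxz hzy => h.wcovBy.eq_or_eq hxz hzy⟩

end Width

section UpperShadow

variable {α : Type*} [PartialOrder α] {C U : Finset α}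

lemma exists_covBy_le_of_ordConnected (hC : Set.OrdConnected (C : Set α)) {x y : α} (hx : x ∈ C)
    (hy : y ∈ C) (hxy : x < y) : ∃ z ∈ C, x ⋖ z ∧ z ≤ y := by
  have hsub : (⟨x, hx⟩ : C) < ⟨y, hy⟩ := hxy
  obtain ⟨z, hxz, hzy⟩ := exists_covBy_le_of_lt hsub
  refine ⟨z, z.2, ?_, hzy⟩
  exact hxz.image (OrderEmbedding.subtype (· ∈ C)) (by simpa using hC)

/-- The elements of `C` that cover `x` in the ambient order. -/
noncomputable def upperCovers (C : Finset α) (x : α) : Finset α :=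
  open Classical in {y ∈ C | x ⋖ y}

lemma mem_upperCovers {x y : α} : y ∈ upperCovers C x ↔ y ∈ C ∧ x ⋖ y := by
  simp only [upperCovers, mem_filter]

/-- The upper shadow of `U` within `C`: the elements of `C` that cover some element of `U`. -/
noncomputable abbrev upperShadow [DecidableEq α] (C U : Finset α) : Finset α :=
  U.biUnion (upperCovers C)

variable [DecidableEq α]

lemma mem_upperShadow {z : α} : z ∈ upperShadow C U ↔ z ∈ C ∧ ∃ u ∈ U, u ⋖ z := by
  simp only [upperShadow, mem_biUnion, mem_upperCovers]
  tauto

lemma upperShadow_subset : upperShadow C U ⊆ C :=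
  fun _ hz => (mem_upperShadow.1 hz).1

lemma isAntichain_sdiff_upperShadow (hC : Set.OrdConnected (C : Set α)) (hUC : U ⊆ C)
    (hU : upperShadow C U ⊆ U) : IsAntichain (· ≤ ·) (↑(U \ upperShadow C U) : Set α) := by
  intro x hx y hy hne hle
  obtain ⟨hxU, -⟩ := mem_sdiff.1 hx
  obtain ⟨hyU, hyN⟩ := mem_sdiff.1 hy
  classical
  obtain ⟨a, ha⟩ := exists_maximal (s := {a ∈ U | a < y})
    ⟨x, mem_filter.2 ⟨hxU, hle.lt_of_ne hne⟩⟩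
  obtain ⟨haU, hay⟩ := mem_filter.1 ha.1
  obtain ⟨z, hzC, haz, hzy⟩ := exists_covBy_le_of_ordConnected hC (hUC haU) (hUC hyU) hay
  have hzN : z ∈ upperShadow C U := mem_upperShadow.2 ⟨hzC, a, haU, haz⟩
  have hzy' : z < y := hzy.lt_of_ne fun h => hyN (h ▸ hzN)
  exact ha.not_gt (mem_filter.2 ⟨hU hzN, hzy'⟩) haz.lt

end UpperShadow

section Diamond

/-- Every interval of length two has at least two elements strictly between its endpoints. In
lattices of finite length this is relative complementation (Björner). -/
def DiamondProperty (α : Type*) [LT α] : Prop :=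
  ∀ u v z : α, u ⋖ v → v ⋖ z → ∃ w, w ≠ v ∧ u ⋖ w ∧ w ⋖ z

-- The witness is the complement of `v` in the interval from `u` to `z`.
lemma diamondProperty_of_generalizedBooleanAlgebra (α : Type*) [GeneralizedBooleanAlgebra α] :
    DiamondProperty α := by
  intro u v z huv hvz
  have hsup : v ⊔ (u ⊔ z \ v) = z := by
    rw [← sup_assoc, sup_eq_left.2 huv.le, sup_sdiff_cancel_right hvz.le]
  have hinf : v ⊓ (u ⊔ z \ v) = u := by
    rw [inf_sup_left, inf_eq_right.2 huv.le, inf_sdiff_self_right, sup_bot_eq]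
  refine ⟨u ⊔ z \ v, fun h => huv.ne ?_, ?_, ?_⟩
  · rw [← hinf, h, inf_idem]
  · have := inf_covBy_of_covBy_sup_left (a := v) (b := u ⊔ z \ v) (by rwa [hsup])
    rwa [hinf] at this
  · have := covBy_sup_of_inf_covBy_left (a := v) (b := u ⊔ z \ v) (by rwa [hinf])
    rwa [hsup] at this

variable {α : Type*} [SemilatticeSup α] {C U : Finset α}

lemma eq_of_covBy_of_covBy_of_ne {u u' v w : α} (huv : u ⋖ v) (huv' : u' ⋖ v) (huw : u ⋖ w)
    (huw' : u' ⋖ w) (hvw : v ≠ w) : u = u' :=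
  by_contra fun h => hvw <|
    (huv.wcovBy.sup_eq huv'.wcovBy h).symm.trans (huw.wcovBy.sup_eq huw'.wcovBy h)

variable [DecidableEq α]

lemma mem_upperShadow_of_covBy_of_covBy (hC : Set.OrdConnected (C : Set α)) (hUC : U ⊆ C)
    {u v z : α} (hu : u ∈ U) (huv : u ⋖ v) (hvz : v ⋖ z) (hz : z ∈ C) : v ∈ upperShadow C U :=
  mem_upperShadow.2 ⟨hC.out (hUC hu) hz ⟨huv.le, hvz.le⟩, u, hu, huv⟩

open Classical in
lemma card_le_card_filter_upperShadow_covBy (hα : DiamondProperty α)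
    (hC : Set.OrdConnected (C : Set α)) (hUC : U ⊆ C) {v z : α} (hUv : ∀ u ∈ U, u ⋖ v)
    (hvz : v ⋖ z) (hz : z ∈ C) : #U ≤ #{w ∈ upperShadow C U | w ⋖ z} := by
  have hex : ∀ u ∈ U, ∃ w, w ≠ v ∧ u ⋖ w ∧ w ⋖ z := fun u hu => hα u v z (hUv u hu) hvz
  choose! w hne hlower hupper using hex
  refine card_le_card_of_injOn w (fun u hu => mem_filter.2 ⟨?_, hupper u hu⟩)
    fun u hu u' hu' h => ?_
  · exact mem_upperShadow_of_covBy_of_covBy hC hUC hu (hlower u hu) (hupper u hu) hz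
  · exact eq_of_covBy_of_covBy_of_ne (hUv u hu) (hUv u' hu') (hlower u hu)
      (h ▸ hlower u' hu') (hne u hu).symm

/-- The covers `v ⋖ z` in `C` that leave `V`, encoded as pairs `(v, z)` with `v ∈ V` and `z ∉ V`.
They are the incidences double counted in the comparison of `V` with its upper shadow. -/
noncomputable def exitCovers (C V : Finset α) : Finset (α × α) :=
  open Classical in {p ∈ V ×ˢ (upperShadow C V \ V) | p.1 ⋖ p.2}

lemma mem_exitCovers {V : Finset α} {p : α × α} :
    p ∈ exitCovers C V ↔ p.1 ∈ V ∧ p.2 ∈ upperShadow C V \ V ∧ p.1 ⋖ p.2 := by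
  simp only [exitCovers, mem_filter, mem_product, and_assoc]

lemma image_snd_exitCovers (C V : Finset α) :
    (exitCovers C V).image Prod.snd = upperShadow C V \ V := by
  refine (image_subset_iff.2 fun p hp => (mem_exitCovers.1 hp).2.1).antisymm fun z hz => ?_
  obtain ⟨-, v, hv, hvz⟩ := mem_upperShadow.1 (mem_sdiff.1 hz).1
  exact mem_image.2 ⟨(v, z), mem_exitCovers.2 ⟨hv, hz, hvz⟩, rfl⟩

open Classical in
-- `q` is recovered from `m q.1`, which determines `q.1`, and `φ q`, since `q.2 = φ q ⊔ q.1`.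
lemma card_fiber_exitCovers_le {V : Finset α} {m : α → α} {φ : α × α → α} (hm : Set.InjOn m V)
    (hmU : ∀ v ∈ V, m v ∈ U)
    (hφ : ∀ p ∈ exitCovers C V, φ p ≠ p.1 ∧ m p.1 ⋖ φ p ∧ φ p ⋖ p.2) (w : α) :
    #{q ∈ exitCovers C V | φ q = w} ≤ #{u ∈ U | u ⋖ w} := by
  refine card_le_card_of_injOn (fun q => m q.1) (fun q hq => ?_) fun q hq q' hq' h => ?_
  · obtain ⟨hq, hqw⟩ := mem_filter.1 hq
    exact mem_filter.2 ⟨hmU _ (mem_exitCovers.1 hq).1, hqw ▸ (hφ q hq).2.1⟩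
  · obtain ⟨hq, hqw⟩ := mem_filter.1 hq
    obtain ⟨hq', hqw'⟩ := mem_filter.1 hq'
    have hfst : q.1 = q'.1 := hm (mem_exitCovers.1 hq).1 (mem_exitCovers.1 hq').1 h
    have hsup : ∀ r ∈ exitCovers C V, φ r ⊔ r.1 = r.2 := fun r hr =>
      (hφ r hr).2.2.wcovBy.sup_eq (mem_exitCovers.1 hr).2.2.wcovBy (hφ r hr).1
    exact Prod.ext hfst (by rw [← hsup q hq, ← hsup q' hq', hqw, hqw', hfst])

open Classical in
lemma card_filter_upperShadow_covBy_le {V : Finset α} (hUV : upperShadow C U ⊆ V) {z : α}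
    (hz : z ∈ upperShadow C V \ V) :
    #{w ∈ upperShadow C U | w ⋖ z} ≤ #{q ∈ exitCovers C V | q.2 = z} := by
  refine card_le_card_of_injOn (fun w => (w, z)) (fun w hw => ?_)
    fun _ _ _ _ h => congrArg Prod.fst h
  obtain ⟨hw, hwz⟩ := mem_filter.1 hw
  exact mem_filter.2 ⟨mem_exitCovers.2 ⟨hUV hw, hz, hwz⟩, rfl⟩

-- Completing `m v ⋖ v ⋖ z` to a diamond maps the exit covers `(v, z)` of the shadow `V` of `U` to
-- `V \ U`, and the fibres of this map are no larger than those of the projection to `z`.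
lemma card_upperShadow_upperShadow_sdiff_le (hα : DiamondProperty α)
    (hC : Set.OrdConnected (C : Set α)) (hUC : U ⊆ C) {m : α → α}
    (hm : Set.InjOn m (upperShadow C U)) (hmU : ∀ v ∈ upperShadow C U, m v ∈ U ∧ m v ⋖ v) :
    #(upperShadow C (upperShadow C U) \ upperShadow C U) ≤ #(upperShadow C U \ U) := by
  classical
  set V := upperShadow C U
  have hdiamond : ∀ v z, (v, z) ∈ exitCovers C V → ∃ w, w ≠ v ∧ m v ⋖ w ∧ w ⋖ z :=
    fun v z hvz => hα _ _ _ (hmU v (mem_exitCovers.1 hvz).1).2 (mem_exitCovers.1 hvz).2.2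
  choose! ψ hψ using hdiamond
  let φ : α × α → α := fun p => ψ p.1 p.2
  have hφ : ∀ p ∈ exitCovers C V, φ p ≠ p.1 ∧ m p.1 ⋖ φ p ∧ φ p ⋖ p.2 := fun p hp => hψ _ _ hp
  have hC₂ : ∀ p ∈ exitCovers C V, p.2 ∈ C := fun p hp =>
    upperShadow_subset (mem_sdiff.1 (mem_exitCovers.1 hp).2.1).1
  have himage : (exitCovers C V).image φ ⊆ V \ U := image_subset_iff.2 fun p hp => by
    obtain ⟨hv, hz, -⟩ := mem_exitCovers.1 hp
    obtain ⟨-, hlower, hupper⟩ := hφ p hp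
    refine mem_sdiff.2 ⟨?_, fun hU => (mem_sdiff.1 hz).2 ?_⟩
    · exact mem_upperShadow_of_covBy_of_covBy hC hUC (hmU _ hv).1 hlower hupper (hC₂ p hp)
    · exact mem_upperShadow.2 ⟨hC₂ p hp, _, hU, hupper⟩
  have hfiber : ∀ p ∈ exitCovers C V,
      #{q ∈ exitCovers C V | φ q = φ p} ≤ #{q ∈ exitCovers C V | q.2 = p.2} := fun p hp =>
    calc #{q ∈ exitCovers C V | φ q = φ p}
        ≤ #{u ∈ U | u ⋖ φ p} := card_fiber_exitCovers_le hm (fun v hv => (hmU v hv).1) hφ _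
      _ ≤ #{w ∈ upperShadow C {u ∈ U | u ⋖ φ p} | w ⋖ p.2} :=
        card_le_card_filter_upperShadow_covBy hα hC ((filter_subset _ _).trans hUC)
          (fun u hu => (mem_filter.1 hu).2) (hφ p hp).2.2 (hC₂ p hp)
      _ ≤ #{q ∈ exitCovers C V | q.2 = p.2} := card_filter_upperShadow_covBy_le
        (biUnion_subset_biUnion_of_subset_left _ (filter_subset _ _)) (mem_exitCovers.1 hp).2.1
  rw [← image_snd_exitCovers]
  exact (card_image_le_card_image_of_card_fiber_le hfiber).trans (card_le_card himage)

lemma upperShadow_subset_of_maximal (hα : DiamondProperty α) (hC : Set.OrdConnected (C : Set α))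
    (hU : Maximal (IsMaxDeficient (upperCovers C) C) U) : upperShadow C U ⊆ U := by
  set V := upperShadow C U
  have hUC : U ⊆ C := hU.prop.1
  have hUV : U ∪ V ⊆ C := union_subset hUC upperShadow_subset
  have : Nonempty (α → α) := ⟨id⟩
  obtain ⟨m, hm, hmU⟩ := hU.prop.exists_injOn_biUnion
  have hdef : #(upperShadow C V \ V) ≤ #(V \ U) :=
    card_upperShadow_upperShadow_sdiff_le hα hC hUC hm fun v hv =>
      ⟨(hmU v hv).1, (mem_upperCovers.1 (hmU v hv).2).2⟩
  have hcard : #(U ∪ V) = #U + #(V \ U) := by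
    rw [← union_sdiff_self_eq_union, card_union_of_disjoint disjoint_sdiff]
  have hshadow : #(upperShadow C (U ∪ V)) = #V + #(upperShadow C V \ V) := by
    rw [upperShadow, union_biUnion, ← union_sdiff_self_eq_union,
      card_union_of_disjoint disjoint_sdiff]
  have hmax : IsMaxDeficient (upperCovers C) C (U ∪ V) := by
    refine ⟨hUV, fun U' hU' => ?_⟩
    have := hU.prop.2 U' hU'
    change _ + #(upperShadow C (U ∪ V)) ≤ _
    change _ + #V ≤ _ at this
    omega
  exact subset_union_right.trans (hU.le_of_ge hmax subset_union_left)

lemma exists_isAntichain_forall_card_le (hα : DiamondProperty α)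
    (hC : Set.OrdConnected (C : Set α)) :
    ∃ A ⊆ C, IsAntichain (· ≤ ·) (A : Set α) ∧ ∀ U ⊆ C, #U ≤ #(upperShadow C U) + #A := by
  obtain ⟨U, hU⟩ := exists_maximal_isMaxDeficient (upperCovers C) C
  have hUC : U ⊆ C := hU.prop.1
  have hVU : upperShadow C U ⊆ U := upperShadow_subset_of_maximal hα hC hU
  refine ⟨U \ upperShadow C U, sdiff_subset.trans hUC,
    isAntichain_sdiff_upperShadow hC hUC hVU, fun U' hU' => ?_⟩
  have hmax : #U' + #(upperShadow C U) ≤ #U + #(upperShadow C U') := hU.prop.2 U' hU'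
  have hcard := card_sdiff_add_card_eq_card hVU
  omega

end Diamond

theorem theorem10_general {α : Type*} [SemilatticeSup α] [DecidableEq α] (hα : DiamondProperty α)
    (C : Finset α) (hC : Set.OrdConnected (C : Set α)) :
    ∃ P : Finpartition C, IsSDPartition C P ∧ ∀ c ∈ P.parts, ∀ x y, CoversIn c x y → x ⋖ y := by
  obtain ⟨A, hAC, hA, hdef⟩ := exists_isAntichain_forall_card_le hα hC
  have : Nonempty (α → α) := ⟨id⟩
  obtain ⟨M, -, hMA, f, hf, hfM⟩ := exists_injOn_of_card_le_card_biUnion_add hdef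
  simp only [mem_upperCovers] at hfM
  obtain ⟨P, hPM, hP⟩ := exists_finpartition_isChain hf (fun x hx => (hfM x hx).2.lt)
    (fun x hx => (hfM x hx).1)
  have hcov : ∀ c ∈ P.parts, ∀ x y, CoversIn c x y → x ⋖ y := fun c hc x y hxy => by
    obtain ⟨hxM, rfl⟩ := (hP c hc).2 x y hxy
    exact (hfM x hxM).2
  have hle : #P.parts ≤ width C := hPM.trans (hMA.trans (card_le_width_of_isAntichain hA hAC))
  have hge : width C ≤ #P.parts := width_le_card_parts P fun c hc => (hP c hc).1
  exact ⟨P, ⟨hle.antisymm hge, fun c hc => ⟨P.le hc, (hP c hc).1, fun x y hxy =>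
    coversIn_of_covBy (P.le hc hxy.1) (P.le hc hxy.2.1) (hcov c hc x y hxy)⟩⟩, hcov⟩

/-- Every convex family of subsets of an `n`-element set has an SD-partition; in it, consecutive
elements of a chain differ in size by exactly one. -/
theorem theorem10 (n : ℕ) (C : Finset (Finset (Fin n)))
    (hC : Set.OrdConnected (C : Set (Finset (Fin n)))) :
    ∃ P : Finpartition C, IsSDPartition C P ∧
      ∀ c ∈ P.parts, ∀ x y : Finset (Fin n), CoversIn c x y → y.card = x.card + 1 := by
  obtain ⟨P, hP, hcov⟩ :=
    theorem10_general (diamondProperty_of_generalizedBooleanAlgebra (Finset (Fin n))) C hC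
  exact ⟨P, hP, fun c hc x y hxy =>
    (Nat.covBy_iff_add_one_eq.1 (hcov c hc x y hxy).card_finset).symm⟩
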